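/- Let $(\mathbb X,\mathbb A,\mathbb P,r,\gamma)$ be a discounted Markov decision process with finite state set $\mathbb X$, action set $\mathbb A$, transition probabilities $P_a(x,y)$, rewards $r(x,a,y)\in\mathbb R$ and discount factor $\gamma\in[0,1)$, and let $\mathcal F$ be a finite family of controllers $C:\mathbb X\to\mathbb A$. Let $\mathbb Q$ be the space of functions $q:\mathbb X\times\mathcal F\to\mathbb R$ with the supremum norm. Let $\nu:\mathbb X\to 2^{\mathbb X}$ satisfy $x\in\nu(x)$ for all $x$, and let $\mathbf N_\nu:\mathbb Q\to\mathbb Q$ be a neighborhood operator: $\mathbf N_\nu q(x,C)$ depends on $q$ only through the values $q(z,C)$, $z\in\nu(x)$, and $\mathbf N_\nu q(x,C)=q(x,C)$ whenever $\nu(x)=\{x\}$. Assume that $\mathbf N_\nu$ is Borel measurable and of at most linear growth, i.e. $\|\mathbf N_\nu q\|_\infty\le K(1+\|q\|_\infty)$ for some constant $K$ and all $q\in\mathbb Q$, and that the operator $$(\mathbf T_\nu q)(x,C)=\sum_{y\in\mathbb X}P_{C(x)}(x,y)\Big[r(x,C(x),y)+\gamma\sup_{D\in\mathcal F}\mathbf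 N_\nu q(y,D)\Big]$$ is a contraction of $\mathbb Q$ in the supremum norm. On a probability space with a filtration $(\mathcal G_t)_{t\ge 0}$, let the states $x_t\in\mathbb X$, the controllers $C_t\in\mathcal F$ and the step sizes $\alpha_t(x,C)\in\mathbb R$ be $\mathcal G_t$-measurable, and suppose that, for every $t$, the conditional law of $x_{t+1}$ given $\mathcal G_t$ is $P_{C_t(x_t)}(x_t,\cdot)$. Let $r_t=r(x_t,C_t(x_t),x_{t+1})$. Starting from an arbitrary $q_0\in\mathbb Q$, define $$q_{t+1}(x_t,C_t)=q_t(x_t,C_t)+\alpha_t(x_t,C_t)\Big[r_t+\gamma\sup_{D\in\mathcal F}\mathbf N_\nu q_t(x_{t+1},D)-q_t(x_t,C_t)\Big],$$ and $q_{t+1}(x,C)=q_t(x,C)$ for $(x,C)\ne(x_t,C_t)$. Suppose that $0\le\alpha_t(x_t,C_t)\le1$ for all $t$, that the rewards $r_t$ are almost surely bounded by a constant, and that, for every $(x,C)\in\mathbb X\times\mathcal F$, almost surely $$\sum_{t:\,(x_t,C_t)=(x,C)}\alpha_t(x,C)=\infty,\qquad \sum_{t:\,(x_t,C_t)=(x,C)}\alpha_t(x,C)^2<\infty$$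 (in particular every pair $(x,C)$ is visited infinitely often). Then $\mathbf T_\nu$ has a unique fixed point $q_*\in\mathbb Q$, and almost surely $q_t\to q_*$ as $t\to\infty$. -/

import Mathlib

open MeasureTheory ProbabilityTheory Filter Topology

noncomputable section

/-- A discounted Markov decision process with (discrete) state set `X` and action set `A`:
transition law `P x a`, reward `r x a y` of moving from `x` to `y` under action `a`, and
discount factor `γ ∈ [0, 1)`. -/
structure DiscountedMDP (X A : Type*) where
  P : X → A → PMF X
  r : X → A → X → ℝ
  γ : ℝ
  γ_nonneg : 0 ≤ γ
  γ_lt_one : γ < 1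

/-- The `Q`-functions indexed by states and controllers of the family `F`. For finite `X` and `F`
every such function is bounded, and the norm of this space is the supremum norm. -/
abbrev QFun {X A : Type*} (F : Finset (X → A)) : Type _ := X × F → ℝ

/-- `N` is a neighborhood operator for the neighborhood function `ν`: the value `N q (x, C)` is
produced from the values `q (z, C)`, `z ∈ ν x`, and it is `q (x, C)` where `ν x = {x}`. -/
structure IsNeighborhoodOperator {X A : Type*} {F : Finset (X → A)} (ν : X → Set X)
    (N : QFun F → QFun F) : Prop where
  isLocal : ∀ (q q' : QFun F) (x : X) (C : F),
    (∀ z ∈ ν x, q (z, C) = q' (z, C)) → N q (x, C) = N q' (x, C)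
  singleton : ∀ (q : QFun F) (x : X) (C : F), ν x = {x} → N q (x, C) = q (x, C)

namespace DiscountedMDP

variable {X A : Type*} (M : DiscountedMDP X A) {F : Finset (X → A)}

/-- The generalized Bellman operator
`(T q)(x, C) = ∑ y, P_{C(x)}(x, y) * (r(x, C(x), y) + γ * sup_{D ∈ F} (N q)(y, D))`. -/
def bellman [Fintype X] (N : QFun F → QFun F) (q : QFun F) : QFun F := fun p =>
  ∑ y : X, (M.P p.1 (p.2.1 p.1) y).toReal *
    (M.r p.1 (p.2.1 p.1) y + M.γ * ⨆ D : F, N q (y, D))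

/-- The reward `r_t = r(x_t, C_t(x_t), x_{t+1})` collected along the trajectory
`x` under the controllers `C`. -/
def reward (x : ℕ → X) (C : ℕ → F) (t : ℕ) : ℝ :=
  M.r (x t) ((C t).1 (x t)) (x (t + 1))

open Classical in
/-- The generalized `Q`-learning iterates along a trajectory `x` under the controllers `C`, with
step sizes `α t (x, C)`: at time `t` only the entry at `(x_t, C_t)` is changed. -/
def qLearning (N : QFun F → QFun F) (q₀ : QFun F) (x : ℕ → X) (C : ℕ → F)
    (α : ℕ → X × F → ℝ) : ℕ → QFun F
  | 0 => q₀
  | t + 1 =>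
    let q := qLearning N q₀ x C α t
    Function.update q (x t, C t)
      (q (x t, C t) + α t (x t, C t) *
        (M.reward x C t + M.γ * (⨆ D : F, N q (x (t + 1), D)) - q (x t, C t)))

end DiscountedMDP

open Classical in
/-- The step size with which the entry `p` is updated at time `t`: it is `α t p` if
`(x_t, C_t) = p`, and `0` otherwise. -/
def effectiveStep {X A : Type*} {F : Finset (X → A)} (x : ℕ → X) (C : ℕ → F)
    (α : ℕ → X × F → ℝ) (p : X × F) (t : ℕ) : ℝ :=
  if (x t, C t) = p then α t p else 0

/-- The (random) data that drive generalized `Q`-learning, relative to a filtration `ℱ`: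
the states `x_t`, the controllers `C_t` and the step sizes `α_t` are known at time `t`, and given
that information the next state has law `P_{C_t(x_t)}(x_t, ·)`. -/
structure IsQLearningProcess {X A Ω : Type*} {F : Finset (X → A)} [mΩ : MeasurableSpace Ω]
    (M : DiscountedMDP X A) (μ : Measure Ω) (ℱ : Filtration ℕ mΩ)
    (x : ℕ → Ω → X) (C : ℕ → Ω → F) (α : ℕ → Ω → X × F → ℝ) : Prop where
  state_adapted : ∀ t y, MeasurableSet[ℱ t] {ω | x t ω = y}
  controller_adapted : ∀ t D, MeasurableSet[ℱ t] {ω | C t ω = D}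
  step_adapted : ∀ t p, Measurable[ℱ t] (fun ω => α t ω p)
  transition : ∀ t y,
    μ[Set.indicator {ω | x (t + 1) ω = y} (fun _ => (1 : ℝ)) | ℱ t] =ᵐ[μ]
      fun ω => (M.P (x t ω) ((C t ω).1 (x t ω)) y).toReal

end

/-! Banach's theorem gives the fixed point `qstar`. Put `y t = q t - qstar`. Each entry of `y` is
averaged, with its effective step as weight, against a drift of size at most `β * ‖y t‖` plus a
sampling error of conditional mean zero. The error may grow linearly with `q t`. It is therefore
divided by the predictable scale `g t = 1 + max_{s ≤ t} ‖y s‖`, which leaves bounded martingale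
differences `v`.

Since the squared steps are summable, the series of `a * v` converges almost surely
(`exists_ae_tendsto_sum_mul_of_summable_sq`). The rest is pathwise
(`tendsto_zero_of_contracting_average`). Late tails of that series are at most `δ`, and as `g` is
monotone, summation by parts bounds the accumulated noise by `2 * δ * g t`. For small `δ` this is
absorbed by the contraction, so `g` is bounded. The noise then becomes arbitrarily small, and
divergence of the step sums makes each entry forget its past. Any eventual bound `D` on `‖y t‖` thus
improves to `(1 + β) / 2 * D`, and iteration gives the limit `0`. -/

/-! ### Pathwise asynchronous stochastic approximation -/

/-- Weighted averages of a perturbation `g t * v t` stay small when the partial sums of `a * v`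
do, relative to the nondecreasing scale `g`. -/
theorem abs_average_le_of_abs_partialSum_le {a v g n : ℕ → ℝ} {δ : ℝ}
    (ha : ∀ t, a t ∈ Set.Icc (0 : ℝ) 1) (hg : Monotone g) (hg0 : ∀ t, 0 ≤ g t)
    (hn0 : n 0 = 0) (hn : ∀ t, n (t + 1) = (1 - a t) * n t + a t * (g t * v t))
    (hS : ∀ t, |∑ s ∈ Finset.range t, a s * v s| ≤ δ) (t : ℕ) :
    |n t| ≤ 2 * δ * g t := by
  -- Summation by parts: the error of `g * S` as an approximation to `n` involves only `S` and the
  -- increments of `g`. The coefficients `(1 - a t) * g t`, `a t * g t` and `g (t + 1) - g t` add up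
  -- to `g (t + 1)`.
  have key : ∀ t, |n t - g t * ∑ s ∈ Finset.range t, a s * v s| ≤ δ * g t := by
    intro t
    induction t with
    | zero =>
      have h := (abs_nonneg _).trans (hS 0)
      simpa [hn0] using mul_nonneg h (hg0 0)
    | succ t ih =>
      have hs := hS (t + 1)
      have hs' := hS t
      have e := Finset.sum_range_succ (fun s => a s * v s) t
      set S := ∑ s ∈ Finset.range t, a s * v s
      set S' := ∑ s ∈ Finset.range (t + 1), a s * v s
      have h1 : n (t + 1) - g (t + 1) * S' = (1 - a t) * (n t - g t * S) + a t * g t * (-S)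
          + (g (t + 1) - g t) * (-S') := by
        rw [hn, e]; ring
      have ha0 := (ha t).1
      have ha1 : 0 ≤ 1 - a t := by linarith [(ha t).2]
      have hgm : 0 ≤ g (t + 1) - g t := by linarith [hg (Nat.le_succ t)]
      rw [h1]
      calc _ ≤ |(1 - a t) * (n t - g t * S)| + |a t * g t * (-S)|
            + |(g (t + 1) - g t) * (-S')| := abs_add_three _ _ _
        _ = (1 - a t) * |n t - g t * S| + a t * g t * |S| + (g (t + 1) - g t) * |S'| := by
            rw [abs_mul (1 - a t), abs_mul (a t * g t), abs_mul (g (t + 1) - g t), abs_neg,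
              abs_neg, abs_of_nonneg ha1,
              abs_of_nonneg hgm, abs_of_nonneg (mul_nonneg ha0 (hg0 t))]
        _ ≤ (1 - a t) * (δ * g t) + a t * g t * δ + (g (t + 1) - g t) * δ := by
            have := mul_nonneg ha0 (hg0 t)
            gcongr
        _ = δ * g (t + 1) := by ring
  have h1 := key t
  have h2 : |g t * ∑ s ∈ Finset.range t, a s * v s| ≤ g t * δ := by
    rw [abs_mul, abs_of_nonneg (hg0 t)]
    exact mul_le_mul_of_nonneg_left (hS t) (hg0 t)
  have h3 := abs_add_le (n t - g t * ∑ s ∈ Finset.range t, a s * v s)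
    (g t * ∑ s ∈ Finset.range t, a s * v s)
  rw [sub_add_cancel] at h3
  linarith

/-- Convexity. Only drifts before time `t` enter, so `c` may depend on `t`; the boundedness argument
takes `c = g t₀ + β * g t`. -/
theorem abs_average_le {a G z : ℕ → ℝ} {c : ℝ} (ha : ∀ t, a t ∈ Set.Icc (0 : ℝ) 1)
    (hz : ∀ t, z (t + 1) = (1 - a t) * z t + a t * G t) (hz0 : |z 0| ≤ c) (t : ℕ)
    (hG : ∀ s < t, |G s| ≤ c) : |z t| ≤ c := by
  induction t with
  | zero => exact hz0
  | succ t ih =>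
    have ih := ih fun s hs => hG s (hs.trans (Nat.lt_succ_self t))
    have ha1 : 0 ≤ 1 - a t := by linarith [(ha t).2]
    rw [hz]
    calc _ ≤ |(1 - a t) * z t| + |a t * G t| := abs_add_le _ _
      _ = (1 - a t) * |z t| + a t * |G t| := by
        rw [abs_mul, abs_mul, abs_of_nonneg ha1, abs_of_nonneg (ha t).1]
      _ ≤ (1 - a t) * c + a t * c := by
        have := (ha t).1
        gcongr
        exact hG t (Nat.lt_succ_self t)
      _ = c := by ring

/-- The excess over `c` is multiplied by at most `1 - a t ≤ exp (-a t)` at each step, so a divergent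
sum of steps removes the initial value. -/
theorem eventually_abs_average_le {a G z : ℕ → ℝ} {c ε : ℝ} (ha : ∀ t, a t ∈ Set.Icc (0 : ℝ) 1)
    (hsum : Tendsto (fun t => ∑ s ∈ Finset.range t, a s) atTop atTop)
    (hz : ∀ t, z (t + 1) = (1 - a t) * z t + a t * G t)
    (hG : ∀ t, |G t| ≤ c) (hε : 0 < ε) : ∀ᶠ t in atTop, |z t| ≤ c + ε := by
  have key : ∀ t, |z t| - c ≤ Real.exp (-∑ s ∈ Finset.range t, a s) * |z 0| := by
    intro t
    induction t with
    | zero =>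
      have := (abs_nonneg _).trans (hG 0)
      simpa using this
    | succ t ih =>
      have ha1 : 0 ≤ 1 - a t := by linarith [(ha t).2]
      have h1 : |z (t + 1)| ≤ (1 - a t) * |z t| + a t * c := by
        rw [hz]
        calc _ ≤ |(1 - a t) * z t| + |a t * G t| := abs_add_le _ _
          _ = (1 - a t) * |z t| + a t * |G t| := by
            rw [abs_mul, abs_mul, abs_of_nonneg ha1, abs_of_nonneg (ha t).1]
          _ ≤ _ := by
            have := (ha t).1
            gcongr
            exact hG t
      calc |z (t + 1)| - c ≤ (1 - a t) * (|z t| - c) := by linarith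
        _ ≤ (1 - a t) * (Real.exp (-∑ s ∈ Finset.range t, a s) * |z 0|) := by gcongr
        _ ≤ Real.exp (-a t) * (Real.exp (-∑ s ∈ Finset.range t, a s) * |z 0|) := by
          gcongr
          linarith [Real.add_one_le_exp (-a t)]
        _ = _ := by
          rw [← mul_assoc, ← Real.exp_add, Finset.sum_range_succ]
          congr 2
          ring
  have h0 : Tendsto (fun t => Real.exp (-∑ s ∈ Finset.range t, a s) * |z 0|) atTop (𝓝 0) := by
    have := (Real.tendsto_exp_neg_atTop_nhds_zero.comp hsum).mul_const |z 0|
    simpa using this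
  filter_upwards [h0.eventually (gt_mem_nhds hε)] with t ht
  linarith [key t]

/-- A recursively averaged sequence splits into the average of its drift and a small
perturbation. -/
theorem exists_drift_add_noise {a G v g y : ℕ → ℝ} {δ : ℝ}
    (ha : ∀ t, a t ∈ Set.Icc (0 : ℝ) 1) (hg : Monotone g) (hg0 : ∀ t, 0 ≤ g t)
    (hy : ∀ t, y (t + 1) = (1 - a t) * y t + a t * (G t + g t * v t))
    (hS : ∀ t, |∑ s ∈ Finset.range t, a s * v s| ≤ δ) :
    ∃ z : ℕ → ℝ, z 0 = y 0 ∧ (∀ t, z (t + 1) = (1 - a t) * z t + a t * G t) ∧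
      ∀ t, |y t - z t| ≤ 2 * δ * g t := by
  let z : ℕ → ℝ := fun t => Nat.rec (y 0) (fun t zt => (1 - a t) * zt + a t * G t) t
  have hz : ∀ t, z (t + 1) = (1 - a t) * z t + a t * G t := fun t => rfl
  refine ⟨z, rfl, hz, ?_⟩
  refine abs_average_le_of_abs_partialSum_le (n := fun t => y t - z t) ha hg hg0 (sub_self _) ?_ hS
  intro t
  simp only [hy, hz]
  ring

/-- Asynchronous stochastic approximation along one trajectory: if the drift is a weighted
sup-norm contraction towards `0` and the noise, scaled by the running maximum of the iterates,
has convergent weighted sums, then the iterates tend to `0`. -/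
theorem tendsto_zero_of_contracting_average {ι : Type*} [Fintype ι]
    {a G v y : ℕ → ι → ℝ} {β : ℝ} (hβ0 : 0 ≤ β) (hβ1 : β < 1)
    (ha : ∀ t p, a t p ∈ Set.Icc (0 : ℝ) 1)
    (hsum : ∀ p, Tendsto (fun t => ∑ s ∈ Finset.range t, a s p) atTop atTop)
    (hG : ∀ t p, |G t p| ≤ β * ‖y t‖)
    (hy : ∀ t p, y (t + 1) p = (1 - a t p) * y t p +
      a t p * (G t p + (1 + partialSups (fun s => ‖y s‖) t) * v t p))
    (hS : ∀ p, CauchySeq (fun t => ∑ s ∈ Finset.range t, a s p * v s p)) :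
    Tendsto y atTop (𝓝 0) := by
  set g : ℕ → ℝ := fun t => 1 + partialSups (fun s => ‖y s‖) t with hgdef
  have hgm : Monotone g := fun s t h => by
    have := (partialSups (fun s => ‖y s‖)).monotone h
    simp only [hgdef]; linarith
  have hyg : ∀ s t, s ≤ t → ‖y s‖ ≤ g t := fun s t h => by
    have := le_partialSups_of_le (fun s => ‖y s‖) h
    simp only [hgdef]; linarith
  have hg0 : ∀ t, 0 ≤ g t := fun t => (norm_nonneg _).trans (hyg t t le_rfl)
  have hscale : ∀ δ > 0, ∃ t₀, ∀ p t,
      |∑ s ∈ Finset.range t, a (t₀ + s) p * v (t₀ + s) p| ≤ δ := by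
    intro δ hδ
    have h : ∀ p, ∀ᶠ t₀ in atTop, ∀ t,
        |∑ s ∈ Finset.range t, a (t₀ + s) p * v (t₀ + s) p| ≤ δ := by
      intro p
      obtain ⟨m, hm⟩ := Metric.cauchySeq_iff.1 (hS p) δ hδ
      filter_upwards [eventually_ge_atTop m] with t₀ ht₀ t
      have h1 := hm (t₀ + t) (by simp only [ge_iff_le]; omega) t₀ ht₀
      rw [Real.dist_eq, Finset.sum_range_add, add_sub_cancel_left] at h1
      exact h1.le
    exact (eventually_all.2 h).exists
  -- splitting from time `t₀` on
  have hsplit : ∀ δ > 0, ∃ t₀, ∀ p, ∃ z : ℕ → ℝ, z 0 = y t₀ p ∧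
      (∀ t, z (t + 1) = (1 - a (t₀ + t) p) * z t + a (t₀ + t) p * G (t₀ + t) p) ∧
      ∀ t, |y (t₀ + t) p - z t| ≤ 2 * δ * g (t₀ + t) := by
    intro δ hδ
    obtain ⟨t₀, ht₀⟩ := hscale δ hδ
    refine ⟨t₀, fun p => ?_⟩
    exact exists_drift_add_noise (a := fun t => a (t₀ + t) p) (G := fun t => G (t₀ + t) p)
      (v := fun t => v (t₀ + t) p) (g := fun t => g (t₀ + t)) (y := fun t => y (t₀ + t) p)
      (fun t => ha _ p) (fun s t h => hgm (by omega)) (fun t => hg0 _) (fun t => hy (t₀ + t) p)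
      (ht₀ p)
  have hbdd : ∃ B, 0 < B ∧ ∀ t, g t ≤ B := by
    -- With this `δ` the noise costs `(1 - β) / 2 * g t`. Together with the drift the coefficient of
    -- `g t` is `(1 + β) / 2 < 1`, so it can be absorbed on the left.
    obtain ⟨t₀, ht₀⟩ := hsplit ((1 - β) / 4) (by linarith)
    have hle : ∀ t, t₀ ≤ t → g t ≤ 1 + (g t₀ + β * g t + (1 - β) / 2 * g t) := by
      intro t ht
      have hpos : 0 ≤ g t₀ + β * g t + (1 - β) / 2 * g t := by
        have := hg0 t; have := hg0 t₀
        have : 0 ≤ 1 - β := by linarith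
        positivity
      suffices partialSups (fun s => ‖y s‖) t ≤ g t₀ + β * g t + (1 - β) / 2 * g t by
        simp only [hgdef] at this ⊢; linarith
      refine partialSups_le _ _ _ fun s hs => ?_
      have hgt := hg0 t
      have hgt0 := hg0 t₀
      have h1β : 0 ≤ 1 - β := by linarith
      rcases le_total s t₀ with h | h
      · have := hyg s t₀ h
        have : 0 ≤ β * g t + (1 - β) / 2 * g t := by positivity
        linarith
      · obtain ⟨k, rfl⟩ := Nat.exists_eq_add_of_le h
        refine (pi_norm_le_iff_of_nonneg hpos).2 fun p => ?_
        obtain ⟨z, hz0, hz, hn⟩ := ht₀ p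
        have h1 : |z k| ≤ g t₀ + β * g t := by
          refine abs_average_le (a := fun t => a (t₀ + t) p) (G := fun t => G (t₀ + t) p)
            (fun t => ha _ p) hz ?_ k ?_
          · rw [hz0]
            have h2 := norm_le_pi_norm (y t₀) p
            rw [Real.norm_eq_abs] at h2
            have := hyg t₀ t₀ le_rfl
            have : 0 ≤ β * g t := by positivity
            linarith
          · intro s hs'
            have := hG (t₀ + s) p
            have := mul_le_mul_of_nonneg_left (hyg (t₀ + s) t (by omega)) hβ0
            linarith
        have h2 := hn k
        have h3 : (1 - β) / 2 * g (t₀ + k) ≤ (1 - β) / 2 * g t :=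
          mul_le_mul_of_nonneg_left (hgm hs) (by linarith)
        have h4 := abs_add_le (y (t₀ + k) p - z k) (z k)
        rw [sub_add_cancel] at h4
        rw [Real.norm_eq_abs]
        linarith
    refine ⟨2 * (1 + g t₀) / (1 - β) + g t₀ + 1, ?_, fun t => ?_⟩
    · have := hg0 t₀
      have : 0 < 1 - β := by linarith
      positivity
    · have h1β : 0 < 1 - β := by linarith
      have hgt0 := hg0 t₀
      rcases le_total t t₀ with h | h
      · have := hgm h
        have : 0 ≤ 2 * (1 + g t₀) / (1 - β) := by positivity
        linarith
      · have h1 : g t ≤ 2 * (1 + g t₀) / (1 - β) := by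
          rw [le_div_iff₀ h1β]
          linarith [hle t h]
        linarith
  obtain ⟨B, hB0, hB⟩ := hbdd
  -- one contraction step
  have hstep : ∀ D > 0, (∀ᶠ t in atTop, ‖y t‖ ≤ D) →
      ∀ᶠ t in atTop, ‖y t‖ ≤ (1 + β) / 2 * D := by
    intro D hD hev
    have h1β : 0 < 1 - β := by linarith
    -- Chosen so that `β * D + 2 * ε = (1 + β) / 2 * D`: one `ε` pays for the forgotten initial
    -- value, the other for the noise `2 * δ * B` with `δ = ε / (2 * B)`.
    set ε := (1 - β) / 4 * D with hε
    have hε0 : 0 < ε := by positivity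
    obtain ⟨m, hm⟩ := eventually_atTop.1 hev
    obtain ⟨t₀, ht₀⟩ := hsplit (ε / (2 * B)) (by positivity)
    have hcoord : ∀ p, ∀ᶠ t in atTop, |y (t₀ + t) p| ≤ (1 + β) / 2 * D := by
      intro p
      obtain ⟨z, hz0, hz, hn⟩ := ht₀ p
      -- The shift by `m` restricts to times at which `‖y‖ ≤ D` already holds.
      have hzs : ∀ᶠ t in atTop, |z (t + m)| ≤ β * D + ε := by
        refine eventually_abs_average_le (a := fun t => a (t₀ + (t + m)) p)
          (G := fun t => G (t₀ + (t + m)) p) (fun t => ha _ p) ?_ (fun t => ?_) (fun t => ?_) hε0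
        · have h1 := (tendsto_add_atTop_iff_nat (t₀ + m)).2 (hsum p)
          have h2 := tendsto_atTop_add_const_right _ (-∑ s ∈ Finset.range (t₀ + m), a s p) h1
          refine h2.congr fun t => ?_
          rw [add_comm t, Finset.sum_range_add]
          have : ∀ s, t₀ + m + s = t₀ + (s + m) := fun s => by omega
          simp only [this]
          ring
        · have := hz (t + m)
          rw [show t + 1 + m = t + m + 1 by omega]
          exact this
        · exact (hG _ p).trans (mul_le_mul_of_nonneg_left (hm _ (by omega)) hβ0)
      have hzs' : ∀ᶠ t in atTop, |z t| ≤ β * D + ε := by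
        obtain ⟨k, hk⟩ := eventually_atTop.1 hzs
        filter_upwards [eventually_ge_atTop (k + m)] with t ht
        have := hk (t - m) (by omega)
        rwa [Nat.sub_add_cancel (by omega)] at this
      filter_upwards [hzs'] with t ht
      have h2 : 2 * (ε / (2 * B)) * g (t₀ + t) ≤ 2 * (ε / (2 * B)) * B :=
        mul_le_mul_of_nonneg_left (hB _) (by positivity)
      have h3 : 2 * (ε / (2 * B)) * B = ε := by field_simp
      have h4 := abs_add_le (y (t₀ + t) p - z t) (z t)
      rw [sub_add_cancel] at h4
      have := hn t
      have : (1 + β) / 2 * D = β * D + ε + ε := by rw [hε]; ring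
      linarith
    obtain ⟨k, hk⟩ := eventually_atTop.1 (eventually_all.2 hcoord)
    filter_upwards [eventually_ge_atTop (t₀ + k)] with t ht
    have hpos : 0 ≤ (1 + β) / 2 * D := by positivity
    refine (pi_norm_le_iff_of_nonneg hpos).2 fun p => ?_
    have := hk (t - t₀) (by omega) p
    rwa [Nat.add_sub_cancel' (by omega)] at this
  have hiter : ∀ k : ℕ, ∀ᶠ t in atTop, ‖y t‖ ≤ ((1 + β) / 2) ^ k * B := by
    intro k
    induction k with
    | zero => exact Eventually.of_forall fun t => by simpa using (hyg t t le_rfl).trans (hB t)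
    | succ k ih =>
      have := hstep _ (by positivity) ih
      rwa [← mul_assoc, ← pow_succ'] at this
  rw [tendsto_zero_iff_norm_tendsto_zero, Metric.tendsto_atTop]
  intro ε hε
  have h0 : Tendsto (fun k : ℕ => ((1 + β) / 2) ^ k * B) atTop (𝓝 0) := by
    simpa using (tendsto_pow_atTop_nhds_zero_of_lt_one (by positivity)
      (by linarith : (1 + β) / 2 < 1)).mul_const B
  obtain ⟨k, hk⟩ := (h0.eventually (gt_mem_nhds hε)).exists
  obtain ⟨m, hm⟩ := eventually_atTop.1 (hiter k)
  refine ⟨m, fun t ht => ?_⟩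
  rw [Real.dist_eq, sub_zero, abs_of_nonneg (norm_nonneg _)]
  exact (hm t ht).trans_lt hk

/-! ### Almost sure convergence of martingale-difference series -/

section MartingaleDifferences

variable {Ω : Type*} [mΩ : MeasurableSpace Ω] {μ : Measure Ω} [IsProbabilityMeasure μ]
  {ℱ : Filtration ℕ mΩ}

theorem integrable_of_measurable_of_abs_le {m : MeasurableSpace Ω} (hm : m ≤ mΩ) {f : Ω → ℝ}
    (hf : Measurable[m] f) {K : ℝ} (hK : ∀ ω, |f ω| ≤ K) : Integrable f μ :=
  Integrable.of_bound (hf.mono hm le_rfl).aestronglyMeasurable K (ae_of_all _ hK)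

/-- Martingales with bounded differences whose squares have a bounded sum converge. -/
theorem exists_ae_tendsto_sum_of_sum_sq_le {D : ℕ → Ω → ℝ} {K R : ℝ}
    (hD : ∀ n, Measurable[ℱ (n + 1)] (D n)) (hK : ∀ n ω, |D n ω| ≤ K)
    (hcond : ∀ n, μ[D n | ℱ n] =ᵐ[μ] 0)
    (hR : ∀ n ω, ∑ s ∈ Finset.range n, D s ω ^ 2 ≤ R) :
    ∀ᵐ ω ∂μ, ∃ c, Tendsto (fun n => ∑ s ∈ Finset.range n, D s ω) atTop (𝓝 c) := by
  set S : ℕ → Ω → ℝ := fun n ω => ∑ s ∈ Finset.range n, D s ω with hSdef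
  have hSm : ∀ n, Measurable[ℱ n] (S n) := fun n =>
    Finset.measurable_fun_sum _ fun s hs =>
      (hD s).mono (ℱ.mono (Finset.mem_range.1 hs)) le_rfl
  have hSb : ∀ n ω, |S n ω| ≤ n * K := fun n ω => by
    refine (Finset.abs_sum_le_sum_abs _ _).trans ?_
    refine (Finset.sum_le_sum fun s _ => hK s ω).trans ?_
    simp
  have hSi : ∀ n, Integrable (S n) μ := fun n =>
    integrable_of_measurable_of_abs_le (ℱ.le n) (hSm n) (hSb n)
  have hDi : ∀ n, Integrable (D n) μ := fun n =>
    integrable_of_measurable_of_abs_le (ℱ.le _) (hD n) (hK n)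
  have hDsq : ∀ n, Integrable (fun ω => D n ω ^ 2) μ := fun n =>
    integrable_of_measurable_of_abs_le (K := K ^ 2) (ℱ.le _) ((hD n).pow_const 2) fun ω => by
      rw [abs_pow]
      exact pow_le_pow_left₀ (abs_nonneg _) (hK n ω) 2
  have hSsq : ∀ n, Integrable (fun ω => S n ω ^ 2) μ := fun n =>
    integrable_of_measurable_of_abs_le (K := (n * K) ^ 2) (ℱ.le _) ((hSm n).pow_const 2)
      fun ω => by
        rw [abs_pow]
        exact pow_le_pow_left₀ (abs_nonneg _) (hSb n ω) 2
  have hmart : Martingale S ℱ μ := by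
    refine martingale_of_condExp_sub_eq_zero_nat (fun n => (hSm n).stronglyMeasurable) hSi ?_
    intro n
    have : S (n + 1) - S n = D n := by
      ext ω
      simp [hSdef, Finset.sum_range_succ]
    rw [this]
    exact hcond n
  have hcross : ∀ n, Integrable (S n * D n) μ ∧ ∫ ω, (S n * D n) ω ∂μ = 0 := by
    intro n
    refine ⟨(hDi n).bdd_mul (hSi n).aestronglyMeasurable (ae_of_all _ (hSb n)), ?_⟩
    have h := condExp_stronglyMeasurable_mul_of_bound (μ := μ) (ℱ.le n)
      (hSm n).stronglyMeasurable (hDi n) (n * K) (ae_of_all _ (hSb n))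
    rw [← integral_condExp (ℱ.le n), integral_congr_ae h]
    have h2 : S n * μ[D n | ℱ n] =ᵐ[μ] 0 := by
      filter_upwards [hcond n] with ω hω
      simp [hω]
    rw [integral_congr_ae h2]
    simp
  -- Increments are orthogonal, so `R` bounds the second moments. This yields the uniform `L¹` bound
  -- needed for martingale convergence.
  have hL2 : ∀ n, ∫ ω, S n ω ^ 2 ∂μ = ∫ ω, ∑ s ∈ Finset.range n, D s ω ^ 2 ∂μ := by
    intro n
    induction n with
    | zero => simp [hSdef]
    | succ n ih =>
      have h1 : ∀ ω, S (n + 1) ω ^ 2 = S n ω ^ 2 + 2 * (S n * D n) ω + D n ω ^ 2 := fun ω => by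
        simp only [hSdef, Finset.sum_range_succ, Pi.mul_apply]
        ring
      simp_rw [h1, Finset.sum_range_succ]
      have h2 : Integrable (fun ω => S n ω ^ 2 + 2 * (S n * D n) ω) μ :=
        (hSsq n).add ((hcross n).1.const_mul 2)
      rw [integral_add h2 (hDsq n), integral_add (hSsq n) ((hcross n).1.const_mul 2), integral_const_mul, (hcross n).2, ih,
        integral_add (integrable_finsetSum _ fun s _ => hDsq s) (hDsq n)]
      simp
  have hL1 : ∀ n, ∫ ω, |S n ω| ∂μ ≤ 1 + R := by
    intro n
    have h1 : ∫ ω, |S n ω| ∂μ ≤ ∫ ω, (1 + S n ω ^ 2) ∂μ := by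
      refine integral_mono (hSi n).abs ((integrable_const _).add (hSsq n)) fun ω => ?_
      simp only
      nlinarith [sq_nonneg (|S n ω| - 1), sq_abs (S n ω), sq_nonneg (S n ω)]
    have h2 : ∫ ω, ∑ s ∈ Finset.range n, D s ω ^ 2 ∂μ ≤ ∫ _, R ∂μ :=
      integral_mono (integrable_finsetSum _ fun s _ => hDsq s) (integrable_const _) (hR n)
    rw [integral_add (integrable_const _) (hSsq n), hL2] at h1
    simp only [integral_const, probReal_univ, smul_eq_mul, one_mul] at h1 h2
    linarith
  refine hmart.submartingale.exists_ae_tendsto_of_bdd (R := (1 + R).toNNReal) fun n => ?_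
  rw [eLpNorm_one_eq_lintegral_enorm, ← ofReal_integral_norm_eq_lintegral_enorm (hSi n)]
  exact ENNReal.ofReal_le_ofReal (hL1 n)

/-- A series of bounded martingale differences, weighted by predictable square-summable weights,
converges almost surely. -/
theorem exists_ae_tendsto_sum_mul_of_summable_sq {b v : ℕ → Ω → ℝ} {K : ℝ}
    (hb : ∀ n, Measurable[ℱ n] (b n)) (hb1 : ∀ n ω, |b n ω| ≤ 1)
    (hv : ∀ n, Measurable[ℱ (n + 1)] (v n)) (hK : ∀ n ω, |v n ω| ≤ K)
    (hcond : ∀ n, μ[v n | ℱ n] =ᵐ[μ] 0)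
    (hsq : ∀ᵐ ω ∂μ, Summable fun n => b n ω ^ 2) :
    ∀ᵐ ω ∂μ, ∃ c, Tendsto (fun n => ∑ s ∈ Finset.range n, b s ω * v s ω) atTop (𝓝 c) := by
  classical
  -- weights stopped when the sum of their squares exceeds `R`
  let E : ℕ → ℕ → Set Ω := fun R n => {ω | ∑ s ∈ Finset.range (n + 1), b s ω ^ 2 ≤ R}
  let d : ℕ → ℕ → Ω → ℝ := fun R n => (E R n).indicator (b n)
  -- The sum includes the weight at time `n` itself, which is known at time `n`. Hence `d` stays
  -- predictable and its squares never sum to more than `R`.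
  have hE : ∀ R n, MeasurableSet[ℱ n] (E R n) := fun R n => by
    refine measurableSet_le (Finset.measurable_fun_sum _ fun s hs => ?_) measurable_const
    exact ((hb s).mono (ℱ.mono (Nat.lt_succ_iff.1 (Finset.mem_range.1 hs))) le_rfl).pow_const 2
  have hd : ∀ R n, Measurable[ℱ n] (d R n) := fun R n => (hb n).indicator (hE R n)
  have hd1 : ∀ R n ω, |d R n ω| ≤ 1 := fun R n ω => by
    by_cases h : ω ∈ E R n
    · simpa [d, h] using hb1 n ω
    · simp [d, h]
  have hdsum : ∀ (R n : ℕ) ω, ∑ s ∈ Finset.range n, d R s ω ^ 2 ≤ R := by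
    intro R n ω
    induction n with
    | zero => simp
    | succ n ih =>
      by_cases h : ω ∈ E R n
      · refine le_trans (Finset.sum_le_sum fun s _ => ?_) (show _ ≤ _ from h)
        by_cases h' : ω ∈ E R s
        · simp [d, h']
        · simp [d, h', sq_nonneg]
      · rw [Finset.sum_range_succ]
        simpa [d, h] using ih
  have hconv : ∀ R : ℕ, ∀ᵐ ω ∂μ, ∃ c,
      Tendsto (fun n => ∑ s ∈ Finset.range n, d R s ω * v s ω) atTop (𝓝 c) := by
    intro R
    refine exists_ae_tendsto_sum_of_sum_sq_le (ℱ := ℱ) (μ := μ) (D := fun n ω => d R n ω * v n ω)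
      (K := K) (R := R * K ^ 2) (fun n => ?_) (fun n ω => ?_) (fun n => ?_) (fun n ω => ?_)
    · exact ((hd R n).mono (ℱ.mono (Nat.le_succ n)) le_rfl).mul (hv n)
    · rw [abs_mul]
      calc |d R n ω| * |v n ω| ≤ 1 * K :=
            mul_le_mul (hd1 R n ω) (hK n ω) (abs_nonneg _) zero_le_one
        _ = K := one_mul K
    · have h := condExp_stronglyMeasurable_mul_of_bound (μ := μ) (ℱ.le n)
        (hd R n).stronglyMeasurable
        (integrable_of_measurable_of_abs_le (ℱ.le _) (hv n) (hK n)) 1 (ae_of_all _ (hd1 R n))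
      refine EventuallyEq.trans h ?_
      filter_upwards [hcond n] with ω hω
      simp [hω]
    · calc ∑ s ∈ Finset.range n, (d R s ω * v s ω) ^ 2
          ≤ ∑ s ∈ Finset.range n, d R s ω ^ 2 * K ^ 2 := by
            refine Finset.sum_le_sum fun s _ => ?_
            rw [mul_pow, ← sq_abs (v s ω)]
            have := hK s ω
            gcongr
        _ ≤ R * K ^ 2 := by
            rw [← Finset.sum_mul]
            exact mul_le_mul_of_nonneg_right (hdsum R n ω) (sq_nonneg K)
  filter_upwards [ae_all_iff.2 hconv, hsq] with ω hω hs
  obtain ⟨R, hR⟩ := exists_nat_ge (∑' n, b n ω ^ 2)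
  obtain ⟨c, hc⟩ := hω R
  refine ⟨c, hc.congr fun n => Finset.sum_congr rfl fun s _ => ?_⟩
  -- A path whose total sum of squares is at most `R` is never stopped, so `d R` and `b` agree along
  -- it.
  have : ω ∈ E R s := (hs.sum_le_tsum _ fun i _ => sq_nonneg _).trans hR
  simp [d, this]

end MartingaleDifferences

/-! ### Measurability, conditional centring and suprema -/

theorem measurable_comp_of_finite {Ω ι : Type*} [Finite ι] {m : MeasurableSpace Ω} {i : Ω → ι}
    {h : ι → Ω → ℝ} (hi : ∀ j, MeasurableSet {ω | i ω = j}) (hh : ∀ j, Measurable (h j)) :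
    Measurable fun ω => h (i ω) ω := by
  intro s hs
  have : (fun ω => h (i ω) ω) ⁻¹' s = ⋃ j, {ω | i ω = j} ∩ h j ⁻¹' s := by
    ext ω
    simp
  rw [this]
  exact MeasurableSet.iUnion fun j => (hi j).inter (hh j hs)

theorem measurable_average {Ω : Type*} {m : MeasurableSpace Ω} {a f h : Ω → ℝ}
    (ha : Measurable a) (hf : Measurable f) (hh : Measurable h) :
    Measurable fun ω => (1 - a ω) * f ω + a ω * h ω := by
  fun_prop

/-- Centring at a constant suffices because `Q` equals `c` wherever `k` is nonzero. In the
application `k` lives on the visits to one entry, where the transition probability is fixed. -/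
theorem condExp_mul_sub_const_eq_zero {Ω : Type*} {mΩ : MeasurableSpace Ω} {μ : Measure Ω}
    [IsProbabilityMeasure μ] {m : MeasurableSpace Ω} (hm : m ≤ mΩ) {k Z Q : Ω → ℝ} {c B : ℝ}
    (hk : Measurable[m] k) (hkB : ∀ ω, |k ω| ≤ B) (hZ : Integrable Z μ)
    (hQ : μ[Z | m] =ᵐ[μ] Q) (h0 : ∀ ω, k ω * (Q ω - c) = 0) :
    μ[k * (Z - fun _ => c) | m] =ᵐ[μ] 0 := by
  have h1 := condExp_stronglyMeasurable_mul_of_bound hm hk.stronglyMeasurable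
    (hZ.sub (integrable_const c)) B (ae_of_all _ hkB)
  have h2 := condExp_sub hZ (integrable_const c) m
  rw [condExp_const hm c] at h2
  filter_upwards [h1, h2, hQ] with ω e1 e2 e3
  rw [e1, Pi.mul_apply, e2, Pi.sub_apply, e3, h0, Pi.zero_apply]

theorem abs_iSup_controller_le {X A : Type*} [Fintype X] {F : Finset (X → A)} (f : QFun F)
    (y : X) : |⨆ D : F, f (y, D)| ≤ ‖f‖ := by
  -- An empty family is allowed; its real supremum is `0` by convention.
  rcases isEmpty_or_nonempty F with h | h
  · rw [Real.iSup_of_isEmpty, abs_zero]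
    exact norm_nonneg f
  · obtain ⟨D, hD⟩ := exists_eq_ciSup_of_finite (f := fun D : F => f (y, D))
    rw [← hD]
    exact norm_le_pi_norm f (y, D)

/-! ### Sampled targets and their linear growth -/

namespace DiscountedMDP

variable {X A : Type*} (M : DiscountedMDP X A) {F : Finset (X → A)}

/-- The sampled target of the entry `p` when the next state is `y`. -/
noncomputable def sampledTarget (N : QFun F → QFun F) (q : QFun F) (p : X × F) (y : X) : ℝ :=
  M.r p.1 (p.2.1 p.1) y + M.γ * ⨆ D : F, N q (y, D)

theorem bellman_apply [Fintype X] (N : QFun F → QFun F) (q : QFun F) (p : X × F) :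
    M.bellman N q p =
      ∑ y, (M.P p.1 (p.2.1 p.1) y).toReal * M.sampledTarget N q p y := rfl

open Classical in
-- Giving unvisited entries step `0` makes the asynchronous update one averaging recursion valid at
-- every entry.
theorem qLearning_succ_apply (N : QFun F → QFun F) (q₀ : QFun F) (x : ℕ → X) (C : ℕ → F)
    (α : ℕ → X × F → ℝ) (t : ℕ) (p : X × F) :
    M.qLearning N q₀ x C α (t + 1) p =
      (1 - effectiveStep x C α p t) * M.qLearning N q₀ x C α t p +
        effectiveStep x C α p t *
          M.sampledTarget N (M.qLearning N q₀ x C α t) p (x (t + 1)) := by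
  rw [qLearning]
  by_cases h : (x t, C t) = p
  · subst h
    simp only [effectiveStep, reward, sampledTarget, Function.update_self, if_true]
    ring
  · simp only [effectiveStep, Function.update_of_ne (Ne.symm h), if_neg h]
    ring

theorem measurable_sampledTarget [Fintype X] {N : QFun F → QFun F} (hN : Measurable N)
    (p : X × F) (y : X) : Measurable fun q => M.sampledTarget N q p y := by
  refine measurable_const.add (measurable_const.mul (Measurable.iSup fun D => ?_))
  exact (measurable_pi_apply _).comp hN

/-- Linear growth of the sampled targets, relative to a reference point. -/
theorem exists_abs_sampledTarget_le [Fintype X] {N : QFun F → QFun F} {K : ℝ}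
    (hK : ∀ q, ‖N q‖ ≤ K * (1 + ‖q‖)) (qref : QFun F) :
    ∃ B, 0 ≤ B ∧ ∀ q p y, |M.sampledTarget N q p y| ≤ B * (1 + ‖q - qref‖) := by
  set R : ℝ := ∑ p : X × F, ∑ y, |M.r p.1 (p.2.1 p.1) y| with hR
  have hR0 : 0 ≤ R := by positivity
  have hr : ∀ (p : X × F) y, |M.r p.1 (p.2.1 p.1) y| ≤ R := fun p y =>
    (Finset.single_le_sum (f := fun y => |M.r p.1 (p.2.1 p.1) y|)
      (fun _ _ => abs_nonneg _) (Finset.mem_univ y)).trans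
      (Finset.single_le_sum (f := fun p : X × F => ∑ y, |M.r p.1 (p.2.1 p.1) y|)
        (fun _ _ => Finset.sum_nonneg fun _ _ => abs_nonneg _) (Finset.mem_univ p))
  refine ⟨R + |K| * (1 + ‖qref‖), by positivity, fun q p y => ?_⟩
  have h1 : |⨆ D : F, N q (y, D)| ≤ |K| * (1 + ‖q‖) :=
    (abs_iSup_controller_le _ _).trans ((hK q).trans
      (mul_le_mul_of_nonneg_right (le_abs_self K) (by positivity)))
  have h2 : ‖q‖ ≤ ‖q - qref‖ + ‖qref‖ := by
    simpa using norm_add_le (q - qref) qref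
  have h3 : |M.γ * ⨆ D : F, N q (y, D)| ≤ |K| * (1 + ‖q‖) := by
    rw [abs_mul, abs_of_nonneg M.γ_nonneg]
    exact (mul_le_of_le_one_left (abs_nonneg _) M.γ_lt_one.le).trans h1
  have h4 : |K| * (1 + ‖q‖) ≤ |K| * ((1 + ‖qref‖) * (1 + ‖q - qref‖)) := by
    refine mul_le_mul_of_nonneg_left ?_ (abs_nonneg K)
    nlinarith [mul_nonneg (norm_nonneg qref) (norm_nonneg (q - qref))]
  have h5 : 0 ≤ R * ‖q - qref‖ := by positivity
  calc _ ≤ |M.r p.1 (p.2.1 p.1) y| + |M.γ * ⨆ D : F, N q (y, D)| := abs_add_le _ _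
    _ ≤ _ := by linarith [hr p y]

end DiscountedMDP

/-! ### Adaptedness and centred sampling noise -/

namespace IsQLearningProcess

variable {X A Ω : Type*} {F : Finset (X → A)} [mΩ : MeasurableSpace Ω]
  {M : DiscountedMDP X A} {μ : Measure Ω} {ℱ : Filtration ℕ mΩ}
  {x : ℕ → Ω → X} {C : ℕ → Ω → F} {α : ℕ → Ω → X × F → ℝ}

theorem measurableSet_visit (h : IsQLearningProcess M μ ℱ x C α) (p : X × F) (t : ℕ) :
    MeasurableSet[ℱ t] {ω | (x t ω, C t ω) = p} := by
  have : {ω | (x t ω, C t ω) = p} = {ω | x t ω = p.1} ∩ {ω | C t ω = p.2} := by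
    ext ω
    exact Prod.ext_iff
  rw [this]
  exact (h.state_adapted t p.1).inter (h.controller_adapted t p.2)

theorem measurable_effectiveStep (h : IsQLearningProcess M μ ℱ x C α) (p : X × F) (t : ℕ) :
    Measurable[ℱ t] fun ω =>
      effectiveStep (fun s => x s ω) (fun s => C s ω) (fun s => α s ω) p t :=
  Measurable.ite (h.measurableSet_visit p t) (h.step_adapted t p) measurable_const

theorem measurable_qLearning [Fintype X] (h : IsQLearningProcess M μ ℱ x C α) {N : QFun F → QFun F}
    (hN : Measurable N) (q₀ : QFun F) (t : ℕ) :
    Measurable[ℱ t] fun ω =>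
      M.qLearning N q₀ (fun s => x s ω) (fun s => C s ω) (fun s => α s ω) t := by
  induction t with
  | zero => exact measurable_const
  | succ t ih =>
    have hle := ℱ.mono (Nat.le_succ t)
    have ih' := ih.mono hle le_rfl
    refine @measurable_pi_lambda Ω _ _ (ℱ (t + 1)) _ _ fun p => ?_
    simp_rw [M.qLearning_succ_apply]
    have hb := (h.measurable_effectiveStep p t).mono hle le_rfl
    refine measurable_average hb ((measurable_pi_apply p).comp ih') ?_
    exact measurable_comp_of_finite (i := x (t + 1))
      (h := fun y ω => M.sampledTarget N
        (M.qLearning N q₀ (fun s => x s ω) (fun s => C s ω) (fun s => α s ω) t) p y)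
      (h.state_adapted (t + 1)) fun y => (M.measurable_sampledTarget hN p y).comp ih'

/-- The sampling error of next-state weights `k` that are known at time `t` and vanish off the
visits to `p` has conditional mean zero. -/
theorem condExp_sum_mul_indicator_sub [Fintype X] [IsProbabilityMeasure μ]
    (h : IsQLearningProcess M μ ℱ x C α) (p : X × F) (t : ℕ) {k : X → Ω → ℝ} {B : ℝ}
    (hk : ∀ y, Measurable[ℱ t] (k y)) (hkB : ∀ y ω, |k y ω| ≤ B)
    (hk0 : ∀ y ω, (x t ω, C t ω) ≠ p → k y ω = 0) :
    μ[∑ y, k y * (Set.indicator {ω | x (t + 1) ω = y} (fun _ => (1 : ℝ)) -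
      fun _ => (M.P p.1 (p.2.1 p.1) y).toReal) | ℱ t] =ᵐ[μ] 0 := by
  have hZ : ∀ y, Integrable (Set.indicator {ω | x (t + 1) ω = y} fun _ => (1 : ℝ)) μ := fun y =>
    (integrable_const 1).indicator (ℱ.le _ _ (h.state_adapted (t + 1) y))
  have hterm := fun y => condExp_mul_sub_const_eq_zero (c := (M.P p.1 (p.2.1 p.1) y).toReal)
    (ℱ.le t) (hk y) (hkB y) (hZ y) (h.transition t y) fun ω => by
      by_cases hp : (x t ω, C t ω) = p
      · subst hp
        simp
      · rw [hk0 y ω hp, zero_mul]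
  refine (condExp_finsetSum (fun y _ => ?_) _).trans ?_
  · exact ((hZ y).sub (integrable_const _)).bdd_mul
      ((hk y).mono (ℱ.le t) le_rfl).aestronglyMeasurable (ae_of_all _ (hkB y))
  · filter_upwards [ae_all_iff.2 hterm] with ω hω
    rw [Finset.sum_apply]
    exact Finset.sum_eq_zero fun y _ => hω y

end IsQLearningProcess

/-! ### Convergence of generalized Q-learning -/

theorem mainTheorem1 {X A Ω : Type*} [Fintype X] [mΩ : MeasurableSpace Ω]
    (μ : Measure Ω) [IsProbabilityMeasure μ] (ℱ : Filtration ℕ mΩ)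
    (M : DiscountedMDP X A) (F : Finset (X → A))
    (ν : X → Set X) (_hν : ∀ x, x ∈ ν x)
    (N : QFun F → QFun F) (_hN : IsNeighborhoodOperator ν N)
    (_hN_meas : Measurable N) (_hN_growth : ∃ K : ℝ, ∀ q : QFun F, ‖N q‖ ≤ K * (1 + ‖q‖))
    (_hT : ∃ β : NNReal, ContractingWith β (M.bellman N))
    (x : ℕ → Ω → X) (C : ℕ → Ω → F) (α : ℕ → Ω → X × F → ℝ) (q₀ : QFun F)
    (_hproc : IsQLearningProcess M μ ℱ x C α)
    (_hα : ∀ t ω, α t ω (x t ω, C t ω) ∈ Set.Icc (0 : ℝ) 1)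
    (_hα_sum : ∀ p : X × F, ∀ᵐ ω ∂μ,
      Tendsto (fun n => ∑ t ∈ Finset.range n,
        effectiveStep (fun s => x s ω) (fun s => C s ω) (fun s => α s ω) p t) atTop atTop)
    (_hα_sq : ∀ p : X × F, ∀ᵐ ω ∂μ,
      Summable (fun t =>
        effectiveStep (fun s => x s ω) (fun s => C s ω) (fun s => α s ω) p t ^ 2))
    (_hr : ∃ R : ℝ, ∀ᵐ ω ∂μ, ∀ t,
      |M.reward (fun s => x s ω) (fun s => C s ω) t| ≤ R) :
    ∃ qstar : QFun F,
      Function.IsFixedPt (M.bellman N) qstar ∧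
      (∀ q : QFun F, Function.IsFixedPt (M.bellman N) q → q = qstar) ∧
      ∀ᵐ ω ∂μ, Tendsto
        (fun t => M.qLearning N q₀ (fun s => x s ω) (fun s => C s ω) (fun s => α s ω) t)
        atTop (𝓝 qstar) := by
  classical
  obtain ⟨β, hβ⟩ := _hT
  obtain ⟨K, hK⟩ := _hN_growth
  set qstar := ContractingWith.fixedPoint (M.bellman N) hβ with hqstar
  have hfix : M.bellman N qstar = qstar := hβ.fixedPoint_isFixedPt
  refine ⟨qstar, hfix, fun q hq => hβ.fixedPoint_unique hq, ?_⟩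
  obtain ⟨B, hB0, hB⟩ := M.exists_abs_sampledTarget_le hK qstar
  set q : ℕ → Ω → QFun F := fun t ω =>
    M.qLearning N q₀ (fun s => x s ω) (fun s => C s ω) (fun s => α s ω) t with hq
  set b : X × F → ℕ → Ω → ℝ := fun p t ω =>
    effectiveStep (fun s => x s ω) (fun s => C s ω) (fun s => α s ω) p t with hb
  set g : ℕ → Ω → ℝ := fun t ω => 1 + partialSups (fun s => ‖q s ω - qstar‖) t with hg
  have hqm : ∀ t, Measurable[ℱ t] (q t) := _hproc.measurable_qLearning _hN_meas q₀
  have hbm : ∀ p t, Measurable[ℱ t] (b p t) := _hproc.measurable_effectiveStep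
  have hb01 : ∀ p t ω, b p t ω ∈ Set.Icc (0 : ℝ) 1 := fun p t ω => by
    by_cases h : (x t ω, C t ω) = p
    · subst h
      simpa [hb, effectiveStep] using _hα t ω
    · simp [hb, effectiveStep, h]
  have hgm : ∀ t, Measurable[ℱ t] (g t) := fun t => by
    refine Measurable.const_add ?_ 1
    have hnorm : Measurable fun f : QFun F => ‖f - qstar‖ :=
      (measurable_id.sub_const qstar).norm
    induction t with
    | zero => simpa [Function.comp_def] using hnorm.comp (hqm 0)
    | succ t ih =>
      simp_rw [partialSups_add_one]
      exact (ih.mono (ℱ.mono (Nat.le_succ t)) le_rfl).sup (hnorm.comp (hqm (t + 1)))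
  have hqg : ∀ t ω, 1 + ‖q t ω - qstar‖ ≤ g t ω := fun t ω => by
    have := le_partialSups (fun s => ‖q s ω - qstar‖) t
    simp only [hg]
    linarith
  have hg0 : ∀ t ω, 0 < g t ω := fun t ω => by
    linarith [hqg t ω, norm_nonneg (q t ω - qstar)]
  -- the scaled noise at the entry `p`
  set k : X × F → ℕ → X → Ω → ℝ := fun p t y =>
    Set.indicator {ω | (x t ω, C t ω) = p} fun ω => M.sampledTarget N (q t ω) p y / g t ω with hk
  set Z : ℕ → X → Ω → ℝ := fun t y =>
    Set.indicator {ω | x (t + 1) ω = y} fun _ => (1 : ℝ) with hZ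
  set v : X × F → ℕ → Ω → ℝ := fun p t =>
    ∑ y, k p t y * (Z t y - fun _ => (M.P p.1 (p.2.1 p.1) y).toReal) with hv
  have hkm : ∀ p t y, Measurable[ℱ t] (k p t y) := fun p t y =>
    (((M.measurable_sampledTarget _hN_meas p y).comp (hqm t)).div (hgm t)).indicator
      (_hproc.measurableSet_visit p t)
  -- Division by `g` cancels the linear growth of the targets.
  have hkB : ∀ p t y ω, |k p t y ω| ≤ B := fun p t y ω => by
    by_cases h : (x t ω, C t ω) = p
    · simp only [hk, Set.indicator, Set.mem_ofPred_eq, h, if_true]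
      rw [abs_div, abs_of_pos (hg0 t ω), div_le_iff₀ (hg0 t ω)]
      exact (hB _ _ _).trans (mul_le_mul_of_nonneg_left (hqg t ω) hB0)
    · simpa [hk, h] using hB0
  have hvm : ∀ p t, Measurable[ℱ (t + 1)] (v p t) := fun p t => by
    simp only [hv, Finset.sum_fn]
    refine Finset.measurable_fun_sum _ fun y _ => ?_
    refine ((hkm p t y).mono (ℱ.mono (Nat.le_succ t)) le_rfl).mul (Measurable.sub_const ?_ _)
    exact measurable_const.indicator (_hproc.state_adapted (t + 1) y)
  have hvB : ∀ p t ω, |v p t ω| ≤ Fintype.card X * B := fun p t ω => by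
    simp only [hv, Finset.sum_apply, Pi.mul_apply, Pi.sub_apply]
    refine (Finset.abs_sum_le_sum_abs _ _).trans ?_
    rw [← nsmul_eq_mul, ← Finset.card_univ, ← Finset.sum_const]
    refine Finset.sum_le_sum fun y _ => ?_
    rw [abs_mul]
    have h1 : |Z t y ω - (M.P p.1 (p.2.1 p.1) y).toReal| ≤ 1 := by
      have h2 : (M.P p.1 (p.2.1 p.1) y).toReal ≤ 1 :=
        ENNReal.toReal_le_of_le_ofReal zero_le_one (by simpa using PMF.coe_le_one _ _)
      have h3 : 0 ≤ (M.P p.1 (p.2.1 p.1) y).toReal := ENNReal.toReal_nonneg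
      by_cases h : x (t + 1) ω = y
      · simp only [hZ, Set.indicator, Set.mem_ofPred_eq, h, if_true]
        rw [abs_le]
        constructor <;> linarith
      · simp only [hZ, Set.indicator, Set.mem_ofPred_eq, h, if_false]
        rw [abs_le]
        constructor <;> linarith
    exact (mul_le_of_le_one_right (abs_nonneg _) h1).trans (hkB p t y ω)
  -- On a visit to `p`, `Z` selects the realized next state and the transition probabilities average
  -- the targets to the Bellman value. Off visits the step vanishes.
  have hnoise : ∀ p t ω, b p t ω * (g t ω * v p t ω) =
      b p t ω * (M.sampledTarget N (q t ω) p (x (t + 1) ω) - M.bellman N (q t ω) p) := by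
    intro p t ω
    by_cases h : (x t ω, C t ω) = p
    · congr 1
      have hk' : ∀ y, k p t y ω = M.sampledTarget N (q t ω) p y / g t ω := fun y => by
        simp [hk, h]
      have hne := (hg0 t ω).ne'
      simp only [hv, Finset.sum_apply, Pi.mul_apply, Pi.sub_apply, hk', Finset.mul_sum]
      have e1 : ∀ y, g t ω * (M.sampledTarget N (q t ω) p y / g t ω *
          (Z t y ω - (M.P p.1 (p.2.1 p.1) y).toReal)) =
          M.sampledTarget N (q t ω) p y * Z t y ω -
            (M.P p.1 (p.2.1 p.1) y).toReal * M.sampledTarget N (q t ω) p y := fun y => by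
        field_simp
      simp only [e1, Finset.sum_sub_distrib, M.bellman_apply]
      congr 1
      simp [hZ, Set.indicator_apply]
    · simp [hb, effectiveStep, h]
  have hconv : ∀ p, ∀ᵐ ω ∂μ, ∃ c,
      Tendsto (fun n => ∑ s ∈ Finset.range n, b p s ω * v p s ω) atTop (𝓝 c) := fun p =>
    exists_ae_tendsto_sum_mul_of_summable_sq (hbm p)
      (fun t ω => by rw [abs_of_nonneg (hb01 p t ω).1]; exact (hb01 p t ω).2) (hvm p) (hvB p)
      (fun t => _hproc.condExp_sum_mul_indicator_sub p t (hkm p t) (hkB p t) fun y ω h => by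
        simp [hk, h]) (_hα_sq p)
  filter_upwards [ae_all_iff.2 hconv, ae_all_iff.2 _hα_sum] with ω hω hsum
  have hlim : Tendsto (fun t => q t ω - qstar) atTop (𝓝 0) := by
    refine tendsto_zero_of_contracting_average (a := fun t p => b p t ω)
      (G := fun t p => M.bellman N (q t ω) p - qstar p) (v := fun t p => v p t ω)
      β.coe_nonneg (by exact_mod_cast hβ.1) (fun t p => hb01 p t ω) hsum (fun t p => ?_)
      (fun t p => ?_) (fun p => (hω p).choose_spec.cauchySeq)
    · have h1 := hβ.2.dist_le_mul (q t ω) qstar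
      rw [hfix, dist_eq_norm, dist_eq_norm] at h1
      exact (norm_le_pi_norm (M.bellman N (q t ω) - qstar) p).trans h1
    · have h1 := hnoise p t ω
      have h2 : q (t + 1) ω p = (1 - b p t ω) * q t ω p +
          b p t ω * M.sampledTarget N (q t ω) p (x (t + 1) ω) := M.qLearning_succ_apply ..
      simp only [Pi.sub_apply]
      change _ = (1 - b p t ω) * (q t ω p - qstar p) +
        b p t ω * (M.bellman N (q t ω) p - qstar p + g t ω * v p t ω)
      rw [mul_add (b p t ω), h1, h2]
      ring
  simpa using hlim.add_const qstar
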